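/- An \emph{object of complexity $(c,d)$} is a set $D\subset\mathbb{R}^2$ that is homeomorphic to the closed unit disk and whose boundary $\partial D$ is given as a union of at most $c$ closed $x$-monotone arcs, any two of which meet only in common endpoints; here an $x$-monotone arc is the graph of a continuous function over a compact interval of positive length, or a vertical segment of positive length, and each arc is contained in the zero set of a nonzero bivariate real polynomial of total degree at most $d$. The endpoints of the arcs are the \emph{vertices} of $D$. Objects $D_1,\dots,D_n$ are in \emph{general position} if the boundaries of any two of them meet in finitely many points, at each of which they cross properly (there are no tangencies), and no three of the boundaries have a common point. For a set of objects, the \emph{complexity of its union} is the number of vertices on the boundary of the union (object vertices and intersection points of two object boundaries lying on it) plus the number of its edges (the connected components of $e\setminus\bigcup_{D'\ne D}D'$, over all boundary arcs $e$ of the objects $D$ of the set). For objects drawn on top of each other in the order $D_1,\dots,D_n$, put $W_i=\bigcup_{j>i}D_j$. The \emph{stacking} of this sequence is the subdivision of $D_1\cup\dots\cup D_n$ whose vertices are the points of the sets $\partial D_i\cap\partial W_i$ and the vertices of $D_i$ not in $W_i$, whose edges are the connected components of the sets $e\setminus W_i$ for $e$ a boundary arc of $D_i$, and whose open faces are the connected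 components of the sets $\mathrm{int}(D_i)\setminus W_i$ $(1\le i\le n)$. Its complexity is its total number of vertices, edges and faces. For a permutation $\pi$ of $\{1,\dots,n\}$, let $\mathcal{S}_\pi(\mathcal{D})$ be the stacking of $D_{\pi(1)},\dots,D_{\pi(n)}$ and $|\mathcal{S}_\pi(\mathcal{D})|$ its complexity. \textbf{Lemma.} For all $c,d\in\mathbb{N}$ and $\kappa\ge 0$ there is a constant $C$ such that the following holds. Let $U:\mathbb{N}\to[0,\infty)$ grow at least linearly, in the sense that $U(m)/m\le\kappa\,U(n)/n$ whenever $1\le m\le n$. Let $\mathcal{D}=\{D_1,\dots,D_n\}$ be a set of $n$ objects of complexity $(c,d)$ in general position such that, for every subset $\mathcal{D}'\subseteq\mathcal{D}$, the complexity of the union of $\mathcal{D}'$ is at most $U(|\mathcal{D}'|)$. If $\pi$ is a uniformly random permutation of $\{1,\dots,n\}$, then $$\mathbb{E}\big[|\mathcal{S}_\pi(\mathcal{D})|\big]\le C\,U(n).$$ -/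

import Mathlib

open scoped ENNReal NNReal

noncomputable section

namespace Stacking

/-- A constant-complexity `x`-monotone arc in the plane: the graph of a continuous function over a
nondegenerate compact interval, or a nondegenerate vertical segment, that is contained in the zero
set of a nonzero bivariate polynomial of total degree at most `d`. -/
structure MonotoneArc (d : ℕ) where
  /-- the closed arc, as a set of points -/
  carrier : Set (ℝ × ℝ)
  /-- the two endpoints of the arc -/
  left : ℝ × ℝ
  right : ℝ × ℝ
  monotone :
    (∃ (a b : ℝ) (g : ℝ → ℝ), a < b ∧ ContinuousOn g (Set.Icc a b) ∧
        carrier = (fun x => (x, g x)) '' Set.Icc a b ∧ left = (a, g a) ∧ right = (b, g b)) ∨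
    (∃ x a b : ℝ, a < b ∧
        carrier = (fun y => (x, y)) '' Set.Icc a b ∧ left = (x, a) ∧ right = (x, b))
  algebraic : ∃ P : MvPolynomial (Fin 2) ℝ, P ≠ 0 ∧ P.totalDegree ≤ d ∧
    ∀ p ∈ carrier, MvPolynomial.eval ![p.1, p.2] P = 0

/-- The endpoints of an arc. -/
def MonotoneArc.endpoints {d : ℕ} (e : MonotoneArc d) : Set (ℝ × ℝ) := {e.left, e.right}

/-- An object: a topological disk in the plane whose boundary consists of at most `c` `x`-monotone
arcs of degree at most `d`, any two of which meet only in common endpoints. -/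
structure PlanarObject (c d : ℕ) where
  carrier : Set (ℝ × ℝ)
  isDisk : Nonempty (carrier ≃ₜ Metric.closedBall (0 : ℂ) 1)
  /-- the number of boundary arcs -/
  numArcs : ℕ
  numArcs_le : numArcs ≤ c
  arc : Fin numArcs → MonotoneArc d
  frontier_eq : frontier carrier = ⋃ k, (arc k).carrier
  arcs_meet : ∀ k l, k ≠ l →
    (arc k).carrier ∩ (arc l).carrier ⊆ (arc k).endpoints ∩ (arc l).endpoints

/-- The vertices of an object: the endpoints of its boundary arcs. -/
def PlanarObject.vertices {c d : ℕ} (D : PlanarObject c d) : Set (ℝ × ℝ) :=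
  ⋃ k, (D.arc k).endpoints

/-- The boundary of `D'` crosses the boundary of `D` at `p` (it is not tangent to it there): it has
points arbitrarily close to `p` in the interior of `D`, as well as outside `D`. -/
def CrossesAt {c d : ℕ} (D D' : PlanarObject c d) (p : ℝ × ℝ) : Prop :=
  p ∈ closure (frontier D'.carrier ∩ interior D.carrier) ∧
  p ∈ closure (frontier D'.carrier \ D.carrier)

/-- General position: the boundaries of any two objects meet in finitely many points, at all of
which they cross, and no three boundaries pass through a common point. -/
structure GeneralPosition {c d n : ℕ} (D : Fin n → PlanarObject c d) : Prop where
  finite_inter : ∀ i j, i ≠ j → (frontier (D i).carrier ∩ frontier (D j).carrier).Finite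
  crosses : ∀ i j, i ≠ j → ∀ p ∈ frontier (D i).carrier ∩ frontier (D j).carrier,
    CrossesAt (D i) (D j) p
  no_three : ∀ i j k, i ≠ j → i ≠ k → j ≠ k →
    frontier (D i).carrier ∩ frontier (D j).carrier ∩ frontier (D k).carrier = ∅

/-- The set of connected components of a subset `S` of the plane. -/
def components (S : Set (ℝ × ℝ)) : Set (Set (ℝ × ℝ)) :=
  {K | ∃ x ∈ S, K = connectedComponentIn S x}

section UnionComplexity

variable {c d n : ℕ} (D : Fin n → PlanarObject c d) (T : Finset (Fin n))

/-- The union of the objects with index in `T`. -/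
def unionOf : Set (ℝ × ℝ) := ⋃ i ∈ T, (D i).carrier

/-- The vertices of the union of the objects in `T`: the object vertices and the intersection points
of two object boundaries that lie on the boundary of the union. -/
def unionVertices : Set (ℝ × ℝ) :=
  {p | p ∈ frontier (unionOf D T) ∧
    ((∃ i ∈ T, p ∈ (D i).vertices) ∨
      ∃ i ∈ T, ∃ j ∈ T, i ≠ j ∧ p ∈ frontier (D i).carrier ∩ frontier (D j).carrier)}

/-- The number of edges of the union of the objects in `T`: the maximal connected portions of
boundary arcs not covered by the other objects in `T`. -/
def numUnionEdges : ℕ∞ :=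
  ∑ i ∈ T, ∑ k, (components (((D i).arc k).carrier \ unionOf D (T.erase i))).encard

/-- The combinatorial complexity of the union: the number of vertices and edges on its boundary. -/
def unionComplexity : ℕ∞ := (unionVertices D T).encard + numUnionEdges D T

end UnionComplexity

section Stack

variable {c d n : ℕ} (D : Fin n → PlanarObject c d)

/-- The union of the objects placed on top of the `i`-th one, when the objects are drawn in the
order `D 0, D 1, …, D (n - 1)`. -/
def unionAbove (i : Fin n) : Set (ℝ × ℝ) := ⋃ j, ⋃ (_ : i < j), (D j).carrier

/-- The vertices of the stacking of `D 0, …, D (n - 1)`, drawn in this order. -/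
def stackingVertices : Set (ℝ × ℝ) :=
  ⋃ i, (frontier (D i).carrier ∩ frontier (unionAbove D i)) ∪ ((D i).vertices \ unionAbove D i)

/-- The number of edges of the stacking: the connected components of the visible parts of the
boundary arcs. -/
def numStackingEdges : ℕ∞ :=
  ∑ i, ∑ k, (components (((D i).arc k).carrier \ unionAbove D i)).encard

/-- The number of faces of the stacking: the connected components of the visible parts of the
interiors of the objects. -/
def numStackingFaces : ℕ∞ :=
  ∑ i, (components (interior (D i).carrier \ unionAbove D i)).encard

/-- The combinatorial complexity of the stacking: its number of vertices, edges and faces. -/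
def stackingComplexity : ℕ∞ :=
  (stackingVertices D).encard + numStackingEdges D + numStackingFaces D

/-- The expected complexity of the stacking of the objects in the order `D (π 0), …, D (π (n - 1))`,
where `π` is a uniformly random permutation. -/
def expectedStackingComplexity : ℝ≥0∞ :=
  (∑ π : Equiv.Perm (Fin n), (stackingComplexity (fun i => D (π i)) : ℝ≥0∞)) /
    (Fintype.card (Equiv.Perm (Fin n)) : ℝ≥0∞)

end Stack

end Stacking

end

/-! The expected complexity is computed by backwards analysis. At position `i` the object drawn
there and those above it form a set `T` of `m = n - i` objects, and given `T` each member is equally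
likely to be the lowest. The vertices of the stacking contributed by the lowest object are vertices
of the union of `T` on its boundary, plus at most `2c` of its own
(`frontier_inter_subset_unionVertices`); its visible edges are edges of that union. Since no three
boundaries meet, each union vertex is charged to at most two objects, so summing over the choice of
lowest object costs `O(U(m) + m)` (`sum_layerCost_le`), and the average is `O(U(m)/m + 1)`. The
growth condition bounds this by `O(κ U(n)/n)`, the `1` being absorbed because `U(1) ≥ 1`. Adding up
the `n` positions gives `O(κ U(n))`.

Faces need a separate argument, `numStackingFaces_le`, which charges them to edges and vertices
without Euler's formula. A face is a bounded open set, so its boundary has a point that is not a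
vertex. Near this point the visible boundaries form a single arc with two sides, and the face
touches the arc from one of them. Along a vertex-free connected stretch of visible arc, each side
touches only one face. Hence there are at most twice as many faces as stretches, and cutting the
visible edges at the vertices on them bounds the number of stretches. -/

namespace Stacking

open Set Topology

/-! ### The two local sides of an arc. -/

/-- Near `p`, the set `A` separates the plane into at most two sides: the connected local parts of
`S true` and `S false`. -/
def HasSides (A : Set (ℝ × ℝ)) (S : Bool → Set (ℝ × ℝ)) (p : ℝ × ℝ) : Prop :=
  ∀ B ∈ 𝓝 p, ∃ B' ⊆ B, IsOpen B' ∧ p ∈ B' ∧ (∀ s, IsPreconnected (B' ∩ S s)) ∧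
    (∀ s, Disjoint (B' ∩ S s) A) ∧ B' ⊆ A ∪ (S true ∪ S false) ∧ ∀ s, B' ∩ A ⊆ closure (S s)

lemma isPreconnected_region_between {I : Set ℝ} (hI : Convex ℝ I) {l u : ℝ → ℝ}
    (hl : ContinuousOn l I) (hu : ContinuousOn u I) (hlu : ∀ x ∈ I, l x < u x) :
    IsPreconnected {q : ℝ × ℝ | q.1 ∈ I ∧ l q.1 < q.2 ∧ q.2 < u q.1} := by
  have hc : IsPreconnected (I ×ˢ Ioo (0 : ℝ) 1) := (hI.prod (convex_Ioo 0 1)).isPreconnected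
  have hmaps : MapsTo Prod.fst (I ×ˢ Ioo (0 : ℝ) 1) I := fun q hq => hq.1
  have hl' : ContinuousOn (fun q : ℝ × ℝ => l q.1) (I ×ˢ Ioo (0 : ℝ) 1) :=
    hl.comp continuous_fst.continuousOn hmaps
  have hu' : ContinuousOn (fun q : ℝ × ℝ => u q.1) (I ×ˢ Ioo (0 : ℝ) 1) :=
    hu.comp continuous_fst.continuousOn hmaps
  have hφ : ContinuousOn (fun q : ℝ × ℝ => (q.1, l q.1 + q.2 * (u q.1 - l q.1)))
      (I ×ˢ Ioo (0 : ℝ) 1) :=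
    continuous_fst.continuousOn.prodMk
      (hl'.add (continuous_snd.continuousOn.mul (hu'.sub hl')))
  convert hc.image _ hφ using 1
  ext ⟨x, y⟩
  simp only [mem_ofPred_eq, mem_image, mem_prod, mem_Ioo, Prod.mk.injEq, Prod.exists]
  constructor
  · rintro ⟨hx, h1, h2⟩
    have h := hlu x hx
    refine ⟨x, (y - l x) / (u x - l x), ⟨hx, div_pos (by linarith) (by linarith), ?_⟩, rfl, ?_⟩
    · rw [div_lt_one (by linarith)]; linarith
    · rw [div_mul_cancel₀ _ (by linarith)]; ring
  · rintro ⟨x', t, ⟨hx, h0, h1⟩, rfl, rfl⟩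
    have h := sub_pos.2 (hlu x' hx)
    exact ⟨hx, by nlinarith, by nlinarith⟩

lemma hasSides_graph {a b : ℝ} {g : ℝ → ℝ} (hg : ContinuousOn g (Icc a b)) {x₀ : ℝ}
    (hx₀ : x₀ ∈ Ioo a b) :
    HasSides ((fun x => (x, g x)) '' Icc a b)
      (fun s => if s then {q | g q.1 < q.2} else {q | q.2 < g q.1}) (x₀, g x₀) := by
  intro B hB
  obtain ⟨r, hr, hrB⟩ := Metric.mem_nhds_iff.1 hB
  have hcont : ContinuousAt g x₀ := hg.continuousAt (Icc_mem_nhds hx₀.1 hx₀.2)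
  obtain ⟨δ₁, hδ₁, hδg⟩ := Metric.continuousAt_iff.1 hcont r hr
  -- The base interval stays inside `(a, b)`, and over it the graph stays within height `r` of `g
  -- x₀`; each side of the box is then the region between the graph and a horizontal edge.
  set δ := min (min δ₁ r) (min (x₀ - a) (b - x₀)) with hδ
  have hδpos : 0 < δ := by
    simp only [hδ, lt_min_iff]
    exact ⟨⟨hδ₁, hr⟩, sub_pos.2 hx₀.1, sub_pos.2 hx₀.2⟩
  have hI : ∀ x ∈ Metric.ball x₀ δ, x ∈ Icc a b ∧ dist (g x) (g x₀) < r ∧ dist x x₀ < r := by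
    intro x hx
    have hx' : dist x x₀ < δ := hx
    have h := hx'
    simp only [hδ, lt_min_iff, Real.dist_eq] at h
    refine ⟨⟨?_, ?_⟩, hδg h.1.1, h.1.2⟩
    · linarith [neg_abs_le (x - x₀)]
    · linarith [le_abs_self (x - x₀)]
  have hgI : ContinuousOn g (Metric.ball x₀ δ) := hg.mono fun x hx => (hI x hx).1
  refine ⟨Metric.ball x₀ δ ×ˢ Metric.ball (g x₀) r, ?_, Metric.isOpen_ball.prod Metric.isOpen_ball,
    ⟨Metric.mem_ball_self hδpos, Metric.mem_ball_self hr⟩, ?_, ?_, ?_, ?_⟩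
  · rintro ⟨x, y⟩ ⟨hx, hy⟩
    refine hrB ?_
    rw [← ball_prod_same]
    exact ⟨(hI x hx).2.2, hy⟩
  · rintro (_ | _)
    · convert isPreconnected_region_between (convex_ball x₀ δ)
        (l := fun _ => g x₀ - r) continuousOn_const hgI ?_ using 1
      · ext ⟨x, y⟩
        simp only [Bool.false_eq_true, if_false, mem_inter_iff, mem_prod, mem_ofPred_eq]
        constructor
        · rintro ⟨⟨hx, hy⟩, h⟩
          rw [Metric.mem_ball, Real.dist_eq, abs_lt] at hy
          exact ⟨hx, by linarith, h⟩
        · rintro ⟨hx, hy, h⟩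
          refine ⟨⟨hx, ?_⟩, h⟩
          have := (hI x hx).2.1
          rw [Real.dist_eq, abs_lt] at this
          rw [Metric.mem_ball, Real.dist_eq, abs_lt]
          constructor <;> linarith
      · intro x hx
        have := (hI x hx).2.1
        rw [Real.dist_eq, abs_lt] at this
        linarith
    · convert isPreconnected_region_between (convex_ball x₀ δ)
        (u := fun _ => g x₀ + r) hgI continuousOn_const ?_ using 1
      · ext ⟨x, y⟩
        simp only [if_true, mem_inter_iff, mem_prod, mem_ofPred_eq]
        constructor
        · rintro ⟨⟨hx, hy⟩, h⟩
          rw [Metric.mem_ball, Real.dist_eq, abs_lt] at hy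
          exact ⟨hx, h, by linarith⟩
        · rintro ⟨hx, h, hy⟩
          refine ⟨⟨hx, ?_⟩, h⟩
          have := (hI x hx).2.1
          rw [Real.dist_eq, abs_lt] at this
          rw [Metric.mem_ball, Real.dist_eq, abs_lt]
          constructor <;> linarith
      · intro x hx
        have := (hI x hx).2.1
        rw [Real.dist_eq, abs_lt] at this
        linarith
  · rintro (_ | _) <;>
    · rw [Set.disjoint_left]
      rintro q ⟨_, hq⟩ ⟨x, _, rfl⟩
      simp at hq
  · rintro ⟨x, y⟩ ⟨hx, -⟩
    rcases lt_trichotomy (g x) y with h | h | h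
    · exact Or.inr (Or.inl (by simpa using h))
    · exact Or.inl ⟨x, (hI x hx).1, by simp [h]⟩
    · exact Or.inr (Or.inr (by simpa using h))
  · rintro (_ | _) q ⟨-, x, -, rfl⟩
    · refine map_mem_closure (f := fun y => (x, y)) (by fun_prop)
        (show g x ∈ closure (Iio (g x)) by simp) fun y hy => by simpa using hy
    · refine map_mem_closure (f := fun y => (x, y)) (by fun_prop)
        (show g x ∈ closure (Ioi (g x)) by simp) fun y hy => by simpa using hy

lemma HasSides.preimage {A : Set (ℝ × ℝ)} {S : Bool → Set (ℝ × ℝ)} (φ : (ℝ × ℝ) ≃ₜ (ℝ × ℝ))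
    {p : ℝ × ℝ} (h : HasSides A S (φ p)) : HasSides (φ ⁻¹' A) (fun s => φ ⁻¹' S s) p := by
  intro B hB
  obtain ⟨B', hB', ho, hp, hc, hd, hu, hcl⟩ := h (φ.symm ⁻¹' B)
    (φ.symm.continuous.continuousAt (by simpa using hB))
  refine ⟨φ ⁻¹' B', fun q hq => by simpa using hB' hq, ho.preimage φ.continuous, hp, fun s => ?_,
    fun s => ?_, ?_, fun s => ?_⟩
  · rw [← preimage_inter, φ.isPreconnected_preimage]
    exact hc s
  · rw [← preimage_inter]
    exact (hd s).preimage _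
  · simpa only [preimage_union] using preimage_mono (f := φ) hu
  · rw [← φ.preimage_closure, ← preimage_inter]
    exact preimage_mono (hcl s)

/-- The data of an arc used for counting: a parametrization, a coordinate inverting it, and the two
sides of the arc. -/
lemma MonotoneArc.exists_param {d : ℕ} (e : MonotoneArc d) :
    ∃ (a b : ℝ) (γ : ℝ → ℝ × ℝ) (τ : ℝ × ℝ → ℝ) (S : Bool → Set (ℝ × ℝ)),
      a < b ∧ ContinuousOn γ (Icc a b) ∧ Continuous τ ∧ (∀ t, τ (γ t) = t) ∧
      e.carrier = γ '' Icc a b ∧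
      ∀ p ∈ e.carrier, p ∉ e.endpoints → HasSides e.carrier S p := by
  rcases e.monotone with ⟨a, b, g, hab, hg, hc, hl, hr⟩ | ⟨x, a, b, hab, hc, hl, hr⟩
  · refine ⟨a, b, fun x => (x, g x), Prod.fst,
      fun s => if s then {q | g q.1 < q.2} else {q | q.2 < g q.1}, hab,
      continuousOn_id.prodMk hg, continuous_fst, fun _ => rfl, hc, ?_⟩
    rw [hc]
    rintro _ ⟨x, hx, rfl⟩ hp
    refine hasSides_graph hg ⟨lt_of_le_of_ne hx.1 ?_, lt_of_le_of_ne hx.2 ?_⟩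
    · rintro rfl; exact hp (Or.inl hl.symm)
    · rintro rfl; exact hp (Or.inr hr.symm)
  · refine ⟨a, b, fun y => (x, y), Prod.snd, fun s => (Homeomorph.prodComm ℝ ℝ) ⁻¹'
        (if s then {q | x < q.2} else {q | q.2 < x}), hab, by fun_prop, continuous_snd,
      fun _ => rfl, hc, ?_⟩
    rintro p hpe hp
    have hc' : e.carrier = (Homeomorph.prodComm ℝ ℝ) ⁻¹' ((fun y => (y, x)) '' Icc a b) := by
      rw [hc]
      ext ⟨u, v⟩
      simp [Prod.ext_iff, and_comm]
    rw [hc']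
    rw [hc] at hpe
    obtain ⟨y, hy, rfl⟩ := hpe
    refine HasSides.preimage (Homeomorph.prodComm ℝ ℝ) ?_
    refine hasSides_graph (g := fun _ => x) continuousOn_const
      ⟨lt_of_le_of_ne hy.1 ?_, lt_of_le_of_ne hy.2 ?_⟩
    · rintro rfl; exact hp (Or.inl hl.symm)
    · rintro rfl; exact hp (Or.inr hr.symm)

/-! ### Counting along an arc, and boundaries of bounded open sets. -/

/-- Sets attached to the points of `X \ V`, where `X` lies on an arc parametrized by `γ`, such that
points of a connected subset of `X \ V` determine the same set, are at most as many as the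
components of `X` and the points of `V ∩ X` together. -/
lemma encard_le_components_add {a b : ℝ} {γ : ℝ → ℝ × ℝ} {τ : ℝ × ℝ → ℝ}
    (hγ : ContinuousOn γ (Icc a b)) (hτ : Continuous τ) (hτγ : ∀ t, τ (γ t) = t)
    {X V : Set (ℝ × ℝ)} (hX : X ⊆ γ '' Icc a b) (hV : V.Finite)
    {𝓕 : Set (Set (ℝ × ℝ))} (R : Set (ℝ × ℝ) → ℝ × ℝ → Prop)
    (h₁ : ∀ F ∈ 𝓕, ∃ p ∈ X \ V, R F p)
    (h₂ : ∀ Q ⊆ X \ V, IsPreconnected Q → ∀ p ∈ Q, ∀ p' ∈ Q, ∀ F ∈ 𝓕, ∀ F' ∈ 𝓕,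
      R F p → R F' p' → F = F') :
    𝓕.encard ≤ (components X).encard + (V ∩ X).encard := by
  -- The `τ`-image of a connected set is an interval, so the stretch of arc between two points of
  -- `K` lies in `K`.
  have hsub : ∀ K ⊆ X, IsPreconnected K → ∀ p ∈ K, ∀ p' ∈ K, τ p ≤ τ p' →
      ∃ Q ⊆ K, IsPreconnected Q ∧ p ∈ Q ∧ p' ∈ Q ∧ ∀ q ∈ Q, τ p ≤ τ q ∧ τ q ≤ τ p' := by
    intro K hKX hK p hp p' hp' hpp'
    have hγτ : ∀ q ∈ X, τ q ∈ Icc a b ∧ γ (τ q) = q := by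
      intro q hq
      obtain ⟨t, ht, rfl⟩ := hX hq
      exact ⟨by rwa [hτγ], by rw [hτγ]⟩
    have hord : Icc (τ p) (τ p') ⊆ τ '' K :=
      (hK.image τ hτ.continuousOn).ordConnected.out ⟨p, hp, rfl⟩ ⟨p', hp', rfl⟩
    refine ⟨γ '' Icc (τ p) (τ p'), ?_, ?_, ⟨τ p, left_mem_Icc.2 hpp', (hγτ p (hKX hp)).2⟩,
      ⟨τ p', right_mem_Icc.2 hpp', (hγτ p' (hKX hp')).2⟩, ?_⟩
    · rintro _ ⟨t, ht, rfl⟩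
      obtain ⟨q, hq, rfl⟩ := hord ht
      rwa [(hγτ q (hKX hq)).2]
    · refine isPreconnected_Icc.image _ (hγ.mono ?_)
      exact Icc_subset_Icc (hγτ p (hKX hp)).1.1 (hγτ p' (hKX hp')).1.2
    · rintro _ ⟨t, ht, rfl⟩
      rwa [hτγ]
  -- The code of `p` is the last point of `V` before `p` in its component of `X`, or the component
  -- itself if there is none. Points off `V` with equal codes are joined by a stretch of arc
  -- avoiding `V`.
  let code (p : ℝ × ℝ) (z : Set (ℝ × ℝ) ⊕ (ℝ × ℝ)) : Prop :=
    match z with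
    | .inl K => K = connectedComponentIn X p ∧ ∀ v ∈ V ∩ K, ¬ τ v < τ p
    | .inr v => v ∈ V ∩ connectedComponentIn X p ∧ τ v < τ p ∧
        ∀ w ∈ V ∩ connectedComponentIn X p, τ w < τ p → τ w ≤ τ v
  have hcode : ∀ p ∈ X, ∃ z ∈ Sum.inl '' components X ∪ Sum.inr '' (V ∩ X), code p z := by
    intro p hp
    by_cases h : ∃ v ∈ V ∩ connectedComponentIn X p, τ v < τ p
    · obtain ⟨v₀, hv₀, hlt⟩ := h
      obtain ⟨v, hv, hmax⟩ := Set.exists_max_image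
        {v | v ∈ V ∩ connectedComponentIn X p ∧ τ v < τ p} τ (hV.subset fun v hv => hv.1.1)
        ⟨v₀, hv₀, hlt⟩
      exact ⟨.inr v, Or.inr ⟨v, ⟨hv.1.1, connectedComponentIn_subset _ _ hv.1.2⟩, rfl⟩,
        hv.1, hv.2, fun w hw hwp => hmax w ⟨hw, hwp⟩⟩
    · push Not at h
      exact ⟨.inl _, Or.inl ⟨_, ⟨p, hp, rfl⟩, rfl⟩, rfl, fun v hv => not_lt.2 (h v hv)⟩
  have hkey : ∀ p ∈ X \ V, ∀ p' ∈ X \ V, ∀ z, code p z → code p' z → τ p ≤ τ p' →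
      ∃ Q ⊆ X \ V, IsPreconnected Q ∧ p ∈ Q ∧ p' ∈ Q := by
    intro p hp p' hp' z hz hz' hle
    have hK : connectedComponentIn X p = connectedComponentIn X p' := by
      rcases z with K | v
      · exact hz.1.symm.trans hz'.1
      · rw [connectedComponentIn_eq hz.1.2, connectedComponentIn_eq hz'.1.2]
    obtain ⟨Q, hQK, hQ, hpQ, hpQ', hQle⟩ := hsub _ (connectedComponentIn_subset X p)
      isPreconnected_connectedComponentIn p (mem_connectedComponentIn hp.1) p'
      (hK ▸ mem_connectedComponentIn hp'.1) hle
    refine ⟨Q, fun q hq => ⟨connectedComponentIn_subset _ _ (hQK hq), fun hqV => ?_⟩, hQ, hpQ,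
      hpQ'⟩
    have hinj : ∀ q' ∈ X, τ q = τ q' → q = q' := by
      intro q' hq' h
      obtain ⟨t, -, rfl⟩ := hX (connectedComponentIn_subset _ _ (hQK hq))
      obtain ⟨t', -, rfl⟩ := hX hq'
      rw [hτγ, hτγ] at h
      rw [h]
    have h1 : τ p < τ q := lt_of_le_of_ne (hQle q hq).1 fun h =>
      hp.2 (hinj p hp.1 h.symm ▸ hqV)
    have h2 : τ q < τ p' := lt_of_le_of_ne (hQle q hq).2 fun h =>
      hp'.2 (hinj p' hp'.1 h ▸ hqV)
    rcases z with K | v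
    · exact hz'.2 q ⟨hqV, by rw [hz'.1, ← hK]; exact hQK hq⟩ h2
    · exact absurd (hz'.2.2 q ⟨hqV, hK ▸ hQK hq⟩ h2) (not_le.2 (hz.2.1.trans h1))
  have hchoose : ∀ F, ∃ z : Set (ℝ × ℝ) ⊕ (ℝ × ℝ), F ∈ 𝓕 →
      z ∈ Sum.inl '' components X ∪ Sum.inr '' (V ∩ X) ∧ ∃ p ∈ X \ V, R F p ∧ code p z := by
    intro F
    by_cases hF : F ∈ 𝓕
    · obtain ⟨p, hp, hR⟩ := h₁ F hF
      obtain ⟨z, hz, hpz⟩ := hcode p hp.1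
      exact ⟨z, fun _ => ⟨hz, p, hp, hR, hpz⟩⟩
    -- A dummy value: `f` matters only on `𝓕`.
    · exact ⟨.inl ∅, fun h => absurd h hF⟩
  choose f hf using hchoose
  calc 𝓕.encard ≤ (Sum.inl '' components X ∪ Sum.inr '' (V ∩ X)).encard := by
        refine encard_le_encard_of_injOn (f := f) (fun F hF => (hf F hF).1) ?_
        intro F hF F' hF' hFF'
        obtain ⟨-, p, hp, hR, hz⟩ := hf F hF
        obtain ⟨-, p', hp', hR', hz'⟩ := hf F' hF'
        rw [← hFF'] at hz'
        rcases le_total (τ p) (τ p') with h | h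
        · obtain ⟨Q, hQ, hQc, h1, h2⟩ := hkey p hp p' hp' _ hz hz' h
          exact h₂ Q hQ hQc p h1 p' h2 F hF F' hF' hR hR'
        · obtain ⟨Q, hQ, hQc, h1, h2⟩ := hkey p' hp' p hp _ hz' hz h
          exact h₂ Q hQ hQc p h2 p' h1 F hF F' hF' hR hR'
    _ ≤ _ := by
        refine (encard_union_le _ _).trans_eq ?_
        rw [Sum.inl_injective.encard_image, Sum.inr_injective.encard_image]

/-- A bounded nonempty open set in the plane has infinitely many boundary points. -/
lemma exists_mem_frontier_notMem {F V : Set (ℝ × ℝ)} (hF : IsOpen F) (hne : F.Nonempty)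
    (hb : Bornology.IsBounded F) (hV : V.Finite) : ∃ p ∈ frontier F, p ∉ V := by
  by_contra! h
  have hrank : 1 < Module.rank ℝ (ℝ × ℝ) := by simp [one_add_one_eq_two]
  have hconn : IsPreconnected Vᶜ :=
    (hV.countable.isConnected_compl_of_one_lt_rank hrank).isPreconnected
  have hdense : Dense Vᶜ := by
    simpa using hV.countable.dense_compl ℝ
  -- With its boundary inside `V`, the set `F` is relatively clopen in the connected set `Vᶜ`, hence
  -- contains it.
  have hsub : Vᶜ ⊆ F := by
    refine hconn.subset_of_closure_inter_subset hF ?_ ?_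
    · obtain ⟨x, hx⟩ := hdense.inter_open_nonempty F hF hne
      exact ⟨x, hx.2, hx.1⟩
    · rintro x ⟨hx, hxV⟩
      by_contra hxF
      exact hxV (h x ⟨hx, by rwa [hF.interior_eq]⟩)
  have huniv : Bornology.IsBounded (univ : Set (ℝ × ℝ)) :=
    (hb.union hV.isBounded).subset fun x _ => by
      by_cases hx : x ∈ V
      · exact Or.inr hx
      · exact Or.inl (hsub hx)
  exact NoncompactSpace.noncompact_univ
    (Metric.isCompact_of_isClosed_isBounded isClosed_univ huniv)

/-! ### Basic facts on arcs and objects. -/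

variable {c d n : ℕ}

lemma MonotoneArc.isClosed_carrier (e : MonotoneArc d) : IsClosed e.carrier := by
  obtain ⟨a, b, γ, -, -, -, hγ, -, -, he, -⟩ := e.exists_param
  rw [he]
  exact (isCompact_Icc.image_of_continuousOn hγ).isClosed

lemma MonotoneArc.nonempty_carrier (e : MonotoneArc d) : e.carrier.Nonempty := by
  obtain ⟨a, b, γ, -, -, hab, -, -, -, he, -⟩ := e.exists_param
  rw [he]
  exact (nonempty_Icc.2 hab.le).image _

namespace PlanarObject

lemma isCompact (D : PlanarObject c d) : IsCompact D.carrier := by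
  obtain ⟨φ⟩ := D.isDisk
  have : CompactSpace (Metric.closedBall (0 : ℂ) 1) :=
    isCompact_iff_compactSpace.1 (isCompact_closedBall _ _)
  exact isCompact_iff_compactSpace.2 φ.symm.compactSpace

lemma isClosed (D : PlanarObject c d) : IsClosed D.carrier := D.isCompact.isClosed

lemma frontier_subset (D : PlanarObject c d) : frontier D.carrier ⊆ D.carrier :=
  D.isClosed.frontier_subset

lemma arc_subset_frontier (D : PlanarObject c d) (k : Fin D.numArcs) :
    (D.arc k).carrier ⊆ frontier D.carrier := by
  rw [D.frontier_eq]
  exact subset_iUnion (fun k => (D.arc k).carrier) k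

lemma encard_vertices_le (D : PlanarObject c d) : D.vertices.encard ≤ 2 * c := by
  calc D.vertices.encard ≤ ∑ k, (D.arc k).endpoints.encard := encard_iUnion_le_of_fintype _
    _ ≤ ∑ _k : Fin D.numArcs, 2 := Finset.sum_le_sum fun k _ => by
        unfold MonotoneArc.endpoints
        exact (encard_insert_le _ _).trans (by rw [encard_singleton, one_add_one_eq_two])
    _ ≤ 2 * c := by
        simp only [Finset.sum_const, Finset.card_univ, Fintype.card_fin, nsmul_eq_mul]
        rw [mul_comm]
        gcongr
        exact_mod_cast D.numArcs_le

lemma finite_vertices (D : PlanarObject c d) : D.vertices.Finite :=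
  finite_of_encard_le_coe (k := 2 * c) (by exact_mod_cast D.encard_vertices_le)

lemma nonempty_frontier (D : PlanarObject c d) : (frontier D.carrier).Nonempty := by
  rw [nonempty_iff_ne_empty, Ne, frontier_eq_empty_iff, not_or]
  constructor
  · obtain ⟨φ⟩ := D.isDisk
    exact Nonempty.ne_empty ⟨_, (φ.symm ⟨0, by simp⟩).2⟩
  · intro h
    exact NoncompactSpace.noncompact_univ (h ▸ D.isCompact)

lemma numArcs_pos (D : PlanarObject c d) : 0 < D.numArcs := by
  obtain ⟨p, hp⟩ := D.nonempty_frontier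
  rw [D.frontier_eq] at hp
  obtain ⟨k, -⟩ := mem_iUnion.1 hp
  exact k.pos

end PlanarObject

/-- Double counting of incidences between indices and points. -/
lemma sum_encard_le_mul_encard {ι α : Type*} {T : Finset ι} {X : ι → Set α} {Y : Set α} {m : ℕ}
    (hm : m ≠ 0) (hXY : ∀ i ∈ T, X i ⊆ Y)
    (h : ∀ x ∈ Y, ∀ T' ⊆ T, (∀ i ∈ T', x ∈ X i) → T'.card ≤ m) :
    ∑ i ∈ T, (X i).encard ≤ m * Y.encard := by
  classical
  by_cases hY : Y.Finite
  · have hX : ∀ i ∈ T, (X i).encard =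
        ((Finset.bipartiteAbove (fun i x => x ∈ X i) hY.toFinset i).card : ℕ∞) := by
      intro i hi
      rw [← encard_coe_eq_coe_finsetCard]
      congr 1
      ext x
      simpa [Finset.bipartiteAbove] using fun hx => hXY i hi hx
    rw [Finset.sum_congr rfl hX, hY.encard_eq_coe_toFinset_card]
    norm_cast
    rw [Finset.sum_card_bipartiteAbove_eq_sum_card_bipartiteBelow, mul_comm, ← smul_eq_mul]
    refine Finset.sum_le_card_nsmul _ _ _ fun x hx => h x (hY.mem_toFinset.1 hx) _
      (Finset.filter_subset _ _) fun i hi => (Finset.mem_filter.1 hi).2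
  -- For infinite `Y`, `m ≠ 0` makes the right-hand side `⊤`.
  · rw [Set.Infinite.encard_eq hY, ENat.mul_top (by exact_mod_cast hm)]
    exact le_top

/-! ### Faces of a stacking and their number. -/

section Stack

variable (D : Fin n → PlanarObject c d)

lemma isClosed_unionAbove (i : Fin n) : IsClosed (unionAbove D i) :=
  isClosed_iUnion_of_finite fun j => isClosed_iUnion_of_finite fun _ => (D j).isClosed

variable {D} in
lemma mem_unionAbove {i : Fin n} {p : ℝ × ℝ} :
    p ∈ unionAbove D i ↔ ∃ j, i < j ∧ p ∈ (D j).carrier := by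
  simp [unionAbove]

variable {D} in
lemma subset_unionAbove {i j : Fin n} (h : i < j) : (D j).carrier ⊆ unionAbove D i :=
  fun _ hp => mem_unionAbove.2 ⟨j, h, hp⟩

variable {D} in
lemma exists_mem_frontier_of_mem_frontier_unionAbove {i : Fin n} {p : ℝ × ℝ}
    (hp : p ∈ frontier (unionAbove D i)) : ∃ j, i < j ∧ p ∈ frontier (D j).carrier := by
  obtain ⟨j, hij, hj⟩ := mem_unionAbove.1 ((isClosed_unionAbove D i).frontier_subset hp)
  refine ⟨j, hij, subset_closure hj, fun h => ?_⟩
  exact hp.2 (interior_mono (subset_unionAbove hij) h)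

lemma finite_stackingVertices (h : GeneralPosition D) : (stackingVertices D).Finite := by
  refine finite_iUnion fun i => ((finite_iUnion fun j : {j // i ≠ j} =>
    h.finite_inter i j j.2).subset ?_).union ((D i).finite_vertices.subset sdiff_subset)
  rintro p ⟨hp, hp'⟩
  obtain ⟨j, hij, hj⟩ := exists_mem_frontier_of_mem_frontier_unionAbove hp'
  exact mem_iUnion.2 ⟨⟨j, hij.ne⟩, hp, hj⟩

/-- The visible parts of the boundaries of the objects. -/
def skeleton : Set (ℝ × ℝ) := ⋃ j, frontier (D j).carrier \ unionAbove D j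

/-- The visible part of the interior of an object. -/
def visibleInterior (i : Fin n) : Set (ℝ × ℝ) := interior (D i).carrier \ unionAbove D i

lemma isOpen_visibleInterior (i : Fin n) : IsOpen (visibleInterior D i) :=
  isOpen_interior.sdiff (isClosed_unionAbove D i)

lemma disjoint_diff_unionAbove {i j : Fin n} (h : i ≠ j) :
    Disjoint ((D i).carrier \ unionAbove D i) ((D j).carrier \ unionAbove D j) := by
  rw [Set.disjoint_left]
  rintro p ⟨hi, hi'⟩ ⟨hj, hj'⟩
  rcases lt_or_gt_of_ne h with h | h
  · exact hi' (subset_unionAbove h hj)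
  · exact hj' (subset_unionAbove h hi)

lemma visibleInterior_subset (i : Fin n) :
    visibleInterior D i ⊆ (D i).carrier \ unionAbove D i :=
  sdiff_subset_sdiff_left interior_subset

lemma disjoint_visibleInterior_skeleton (i : Fin n) :
    Disjoint (visibleInterior D i) (skeleton D) := by
  rw [skeleton, disjoint_iUnion_right]
  intro j
  rcases eq_or_ne i j with rfl | h
  · exact disjoint_interior_frontier.mono sdiff_subset sdiff_subset
  · exact (disjoint_diff_unionAbove D h).mono (visibleInterior_subset D i)
      (sdiff_subset_sdiff_left (D j).frontier_subset)

/-- The topmost object containing such a point has it in its visible interior, since otherwise the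
point would be on the skeleton. If that object were above `D i`, it would hide a whole neighbourhood
of the point, which could not be a limit of visible points of `D i`. -/
lemma closure_visibleInterior_diff_skeleton (i : Fin n) :
    closure (visibleInterior D i) \ skeleton D ⊆ visibleInterior D i := by
  rintro p ⟨hp, hps⟩
  have hpi : p ∈ (D i).carrier := closure_minimal
    ((visibleInterior_subset D i).trans sdiff_subset) (D i).isClosed hp
  obtain ⟨j, hij, hj⟩ := (toFinite {j | p ∈ (D j).carrier}).exists_le_maximal hpi
  have hpj : p ∉ unionAbove D j := by
    intro h
    obtain ⟨k, hjk, hk⟩ := mem_unionAbove.1 h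
    exact absurd (hj.2 hk hjk.le) (not_le.2 hjk)
  have hint : p ∈ visibleInterior D j := by
    refine ⟨?_, hpj⟩
    by_contra hni
    exact hps (mem_iUnion.2 ⟨j, ⟨subset_closure hj.1, hni⟩, hpj⟩)
  rcases hij.eq_or_lt with rfl | hlt
  · exact hint
  · obtain ⟨q, hq, hq'⟩ := mem_closure_iff.1 hp _ (isOpen_visibleInterior D j) hint
    exact absurd (subset_unionAbove hlt (interior_subset hq.1)) hq'.2

lemma isPreconnected_subset_visibleInterior {A : Set (ℝ × ℝ)} (hA : IsPreconnected A)
    (hAs : Disjoint A (skeleton D)) {i : Fin n} (h : (A ∩ visibleInterior D i).Nonempty) :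
    A ⊆ visibleInterior D i :=
  hA.subset_of_closure_inter_subset (isOpen_visibleInterior D i) h fun _ hp =>
    closure_visibleInterior_diff_skeleton D i ⟨hp.1, Set.disjoint_left.1 hAs hp.2⟩

/-- The faces of the stacking. -/
def faces : Set (Set (ℝ × ℝ)) := ⋃ i, components (visibleInterior D i)

lemma numStackingFaces_eq : numStackingFaces D = (faces D).encard := by
  rw [faces, encard_iUnion_of_finite, finsum_eq_sum_of_fintype]
  · rfl
  · intro i j hij
    rw [Function.onFun, Set.disjoint_left]
    rintro _ ⟨x, hx, rfl⟩ ⟨y, hy, h⟩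
    refine Set.disjoint_left.1 (disjoint_diff_unionAbove D hij) (visibleInterior_subset D i hx)
      (visibleInterior_subset D j (connectedComponentIn_subset _ y ?_))
    rw [← h]
    exact mem_connectedComponentIn hx

variable {D}

lemma faces_subset_visibleInterior {F : Set (ℝ × ℝ)} (hF : F ∈ faces D) :
    ∃ i, F ⊆ visibleInterior D i := by
  obtain ⟨i, x, hx, rfl⟩ := mem_iUnion.1 hF
  exact ⟨i, connectedComponentIn_subset _ _⟩

lemma disjoint_face_skeleton {F : Set (ℝ × ℝ)} (hF : F ∈ faces D) :
    Disjoint F (skeleton D) := by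
  obtain ⟨i, hi⟩ := faces_subset_visibleInterior hF
  exact (disjoint_visibleInterior_skeleton D i).mono_left hi

lemma isOpen_face {F : Set (ℝ × ℝ)} (hF : F ∈ faces D) : IsOpen F := by
  obtain ⟨i, x, hx, rfl⟩ := mem_iUnion.1 hF
  exact (isOpen_visibleInterior D i).connectedComponentIn

lemma nonempty_face {F : Set (ℝ × ℝ)} (hF : F ∈ faces D) : F.Nonempty := by
  obtain ⟨i, x, hx, rfl⟩ := mem_iUnion.1 hF
  exact ⟨x, mem_connectedComponentIn hx⟩

lemma isBounded_face {F : Set (ℝ × ℝ)} (hF : F ∈ faces D) : Bornology.IsBounded F := by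
  obtain ⟨i, hi⟩ := faces_subset_visibleInterior hF
  exact (D i).isCompact.isBounded.subset
    (hi.trans ((visibleInterior_subset D i).trans sdiff_subset))

lemma isPreconnected_subset_face {F A : Set (ℝ × ℝ)} (hF : F ∈ faces D) (hA : IsPreconnected A)
    (hAs : Disjoint A (skeleton D)) (h : (F ∩ A).Nonempty) : A ⊆ F := by
  obtain ⟨i, x, hx, rfl⟩ := mem_iUnion.1 hF
  obtain ⟨y, hy, hyA⟩ := h
  rw [connectedComponentIn_eq hy]
  exact hA.subset_connectedComponentIn hyA (isPreconnected_subset_visibleInterior D hA hAs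
    ⟨y, hyA, connectedComponentIn_subset _ _ hy⟩)

/-- Connected sets avoiding the skeleton cannot leave a face; this is what makes one side of an arc
determine its face. -/
lemma faces_eq_of_inter_nonempty {F F' A : Set (ℝ × ℝ)} (hF : F ∈ faces D) (hF' : F' ∈ faces D)
    (hA : IsPreconnected A) (hAs : Disjoint A (skeleton D)) (h : (F ∩ A).Nonempty)
    (h' : (F' ∩ A).Nonempty) : F = F' := by
  have key : ∀ G ∈ faces D, ∀ G' ∈ faces D, (G ∩ A).Nonempty → (G' ∩ A).Nonempty → G ⊆ G' := by
    intro G hG G' hG' hGA hGA'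
    have hpre : IsPreconnected G := by
      obtain ⟨i, x, hx, rfl⟩ := mem_iUnion.1 hG
      exact isPreconnected_connectedComponentIn
    refine isPreconnected_subset_face hG' hpre (disjoint_face_skeleton hG) ?_
    obtain ⟨y, hy, hyA⟩ := hGA
    exact ⟨y, isPreconnected_subset_face hG' hA hAs hGA' hyA, hy⟩
  exact (key F hF F' hF' h h').antisymm (key F' hF' F hF h' h)

lemma frontier_face_subset_skeleton {F : Set (ℝ × ℝ)} (hF : F ∈ faces D) :
    frontier F ⊆ skeleton D := by
  intro p hp
  by_contra hps
  obtain ⟨i, x, hx, rfl⟩ := mem_iUnion.1 hF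
  have hpi : p ∈ visibleInterior D i := closure_visibleInterior_diff_skeleton D i
    ⟨closure_mono (connectedComponentIn_subset _ _) hp.1, hps⟩
  obtain ⟨q, hq, hq'⟩ := mem_closure_iff.1 hp.1 _
    (isOpen_visibleInterior D i).connectedComponentIn (mem_connectedComponentIn hpi)
  rw [(isOpen_face hF).frontier_eq] at hp
  apply hp.2
  rw [connectedComponentIn_eq hq', ← connectedComponentIn_eq hq]
  exact mem_connectedComponentIn hpi

/-- Away from the vertices, the skeleton is locally a single arc. -/
lemma eventually_mem_arc {p : ℝ × ℝ} {j : Fin n} {k : Fin (D j).numArcs}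
    (hp : p ∈ ((D j).arc k).carrier \ unionAbove D j) (hpV : p ∉ stackingVertices D) :
    p ∉ ((D j).arc k).endpoints ∧ ∀ᶠ q in 𝓝 p, q ∈ skeleton D → q ∈ ((D j).arc k).carrier := by
  have hend : ∀ l, p ∉ ((D j).arc l).endpoints := fun l h =>
    hpV (mem_iUnion.2 ⟨j, Or.inr ⟨mem_iUnion.2 ⟨l, h⟩, hp.2⟩⟩)
  have hpj : p ∈ (D j).carrier := (D j).frontier_subset ((D j).arc_subset_frontier k hp.1)
  refine ⟨hend k, ?_⟩
  have h₁ : ∀ᶠ q in 𝓝 p, q ∉ unionAbove D j :=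
    (isClosed_unionAbove D j).isOpen_compl.mem_nhds hp.2
  have h₂ : ∀ᶠ q in 𝓝 p, ∀ l, l ≠ k → q ∉ ((D j).arc l).carrier := by
    rw [Filter.eventually_all]
    intro l
    rw [Filter.eventually_all]
    intro hl
    refine ((D j).arc l).isClosed_carrier.isOpen_compl.mem_nhds fun hpl => ?_
    exact hend l ((D j).arcs_meet l k hl ⟨hpl, hp.1⟩).1
  -- Visible boundary points of a lower `D i` accumulating at `p` would put `p` on the boundary both
  -- of `D i` and of the union above `D i`, making it a vertex.
  have h₃ : ∀ᶠ q in 𝓝 p, ∀ i, i < j → q ∉ frontier (D i).carrier \ unionAbove D i := by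
    rw [Filter.eventually_all]
    intro i
    rw [Filter.eventually_all]
    intro hij
    by_contra hcl
    have hcl' : p ∈ closure (frontier (D i).carrier \ unionAbove D i) := by
      rw [mem_closure_iff_frequently]
      exact Filter.not_eventually.1 hcl |>.mono fun q hq => not_not.1 hq
    refine hpV (mem_iUnion.2 ⟨i, Or.inl ⟨?_, subset_closure (subset_unionAbove hij hpj), ?_⟩⟩)
    · exact closure_minimal sdiff_subset isClosed_frontier hcl'
    · intro hint
      obtain ⟨q, hq, hq'⟩ := mem_closure_iff.1 hcl' _ isOpen_interior hint
      exact hq'.2 (interior_subset hq)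
  filter_upwards [h₁, h₂, h₃] with q hq₁ hq₂ hq₃ hqs
  obtain ⟨i, hi⟩ := mem_iUnion.1 hqs
  rcases lt_trichotomy i j with h | rfl | h
  · exact absurd hi (hq₃ i h)
  · have := hi.1
    rw [(D i).frontier_eq] at this
    obtain ⟨l, hl⟩ := mem_iUnion.1 this
    by_cases hlk : l = k
    · exact hlk ▸ hl
    · exact absurd hl (hq₂ l hlk)
  · exact absurd (subset_unionAbove h ((D i).frontier_subset hi.1)) hq₁

lemma arc_diff_subset_skeleton (j : Fin n) (k : Fin (D j).numArcs) :
    ((D j).arc k).carrier \ unionAbove D j ⊆ skeleton D := fun _ hp =>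
  mem_iUnion.2 ⟨j, (D j).arc_subset_frontier k hp.1, hp.2⟩

lemma exists_nhd_sides {p : ℝ × ℝ} {j : Fin n} {k : Fin (D j).numArcs} {S : Bool → Set (ℝ × ℝ)}
    (hS : ∀ p ∈ ((D j).arc k).carrier, p ∉ ((D j).arc k).endpoints →
      HasSides ((D j).arc k).carrier S p)
    (hp : p ∈ (((D j).arc k).carrier \ unionAbove D j) \ stackingVertices D) :
    ∃ B, IsOpen B ∧ p ∈ B ∧ (∀ s, IsPreconnected (B ∩ S s)) ∧
      (∀ s, Disjoint (B ∩ S s) (skeleton D)) ∧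
      B ⊆ ((D j).arc k).carrier ∪ (S true ∪ S false) ∧
      ∀ s, B ∩ ((D j).arc k).carrier ⊆ closure (S s) := by
  obtain ⟨hend, hev⟩ := eventually_mem_arc hp.1 hp.2
  obtain ⟨B, hB, ho, hpB, hc, hd, hu, hcl⟩ := hS p hp.1.1 hend _ hev
  refine ⟨B, ho, hpB, hc, fun s => ?_, hu, hcl⟩
  rw [Set.disjoint_left]
  intro q hq hqs
  exact Set.disjoint_left.1 (hd s) hq (hB hq.1 hqs)

lemma encard_faces_on_side_le (h : GeneralPosition D) {j : Fin n} {k : Fin (D j).numArcs}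
    {a b : ℝ} {γ : ℝ → ℝ × ℝ} {τ : ℝ × ℝ → ℝ} {S : Bool → Set (ℝ × ℝ)}
    (hγ : ContinuousOn γ (Icc a b)) (hτ : Continuous τ) (hτγ : ∀ t, τ (γ t) = t)
    (he : ((D j).arc k).carrier = γ '' Icc a b)
    (hS : ∀ p ∈ ((D j).arc k).carrier, p ∉ ((D j).arc k).endpoints →
      HasSides ((D j).arc k).carrier S p) (s : Bool) :
    {F ∈ faces D | ∃ p ∈ (((D j).arc k).carrier \ unionAbove D j) \ stackingVertices D,
      p ∈ closure (F ∩ S s)}.encard ≤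
      (components (((D j).arc k).carrier \ unionAbove D j)).encard +
        (stackingVertices D ∩ (((D j).arc k).carrier \ unionAbove D j)).encard := by
  refine encard_le_components_add hγ hτ hτγ (he ▸ sdiff_subset) (finite_stackingVertices D h)
    (fun F p => p ∈ closure (F ∩ S s)) (fun F hF => hF.2) ?_
  intro Q hQ hQc p hp p' hp' F hF F' hF' hR hR'
  -- Which faces touch the arc from side `s` is locally constant along `Q`, hence constant.
  have hP := hQc.induction₂ (fun q q' => ∀ G ∈ faces D,
    q ∈ closure (G ∩ S s) ↔ q' ∈ closure (G ∩ S s)) ?_ ?_ ?_ hp hp' F' hF'.1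
  · obtain ⟨B, ho, hpB, hc, hd, -, -⟩ := exists_nhd_sides hS (hQ hp)
    obtain ⟨y, hyB, hyF, hyS⟩ := mem_closure_iff.1 hR _ ho hpB
    obtain ⟨z, hzB, hzF, hzS⟩ := mem_closure_iff.1 (hP.2 hR') _ ho hpB
    exact faces_eq_of_inter_nonempty hF.1 hF'.1 (hc s) (hd s) ⟨y, hyF, hyB, hyS⟩
      ⟨z, hzF, hzB, hzS⟩
  · intro q hq
    obtain ⟨B, ho, hqB, hc, hd, -, hcl⟩ := exists_nhd_sides hS (hQ hq)
    -- The side `B ∩ S s` is connected and off the skeleton, so a face meeting it contains it; and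
    -- every arc point in `B` is a limit of that side.
    have hiff : ∀ q' ∈ B, q' ∈ Q → ∀ G ∈ faces D,
        (q' ∈ closure (G ∩ S s) ↔ (G ∩ (B ∩ S s)).Nonempty) := by
      intro q' hq'B hq' G hG
      constructor
      · intro hq'G
        obtain ⟨y, hyB, hyG, hyS⟩ := mem_closure_iff.1 hq'G _ ho hq'B
        exact ⟨y, hyG, hyB, hyS⟩
      · intro hmeet
        have hsub := isPreconnected_subset_face hG (hc s) (hd s) hmeet
        exact closure_mono (subset_inter hsub inter_subset_right)
          (ho.inter_closure ⟨hq'B, hcl s ⟨hq'B, (hQ hq').1.1⟩⟩)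
    filter_upwards [mem_nhdsWithin_of_mem_nhds (ho.mem_nhds hqB), self_mem_nhdsWithin]
      with q' hq'B hq' G hG
    rw [hiff q hqB hq G hG, hiff q' hq'B hq' G hG]
  · exact fun x y z _ _ _ h1 h2 G hG => (h1 G hG).trans (h2 G hG)
  · exact fun x y _ _ h1 G hG => (h1 G hG).symm

lemma exists_side_of_face (h : GeneralPosition D) {F : Set (ℝ × ℝ)} (hF : F ∈ faces D)
    (S : ∀ j, Fin (D j).numArcs → Bool → Set (ℝ × ℝ))
    (hS : ∀ j k, ∀ p ∈ ((D j).arc k).carrier, p ∉ ((D j).arc k).endpoints →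
      HasSides ((D j).arc k).carrier (S j k) p) :
    ∃ j k s, ∃ p ∈ (((D j).arc k).carrier \ unionAbove D j) \ stackingVertices D,
      p ∈ closure (F ∩ S j k s) := by
  obtain ⟨p, hp, hpV⟩ := exists_mem_frontier_notMem (isOpen_face hF) (nonempty_face hF)
    (isBounded_face hF) (finite_stackingVertices D h)
  obtain ⟨j, hpj, hpW⟩ := mem_iUnion.1 (frontier_face_subset_skeleton hF hp)
  rw [(D j).frontier_eq] at hpj
  obtain ⟨k, hk⟩ := mem_iUnion.1 hpj
  have hp' : p ∈ (((D j).arc k).carrier \ unionAbove D j) \ stackingVertices D :=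
    ⟨⟨hk, hpW⟩, hpV⟩
  obtain ⟨B, -, ho, hpB, -, -, hu, -⟩ := hS j k p hk (eventually_mem_arc hp'.1 hpV).1 _ Filter.univ_mem
  -- Near `p` the face avoids the arc, which is visible there, so it approaches `p` through the two
  -- sides.
  have hcl : p ∈ closure (F ∩ S j k true ∪ F ∩ S j k false) := by
    rw [mem_closure_iff_nhds]
    intro N hN
    obtain ⟨q, hqN, hqF⟩ := mem_closure_iff_nhds.1 hp.1 _
      (Filter.inter_mem hN (Filter.inter_mem (ho.mem_nhds hpB)
        ((isClosed_unionAbove D j).isOpen_compl.mem_nhds hpW)))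
    refine ⟨q, hqN.1, ?_⟩
    rw [← inter_union_distrib_left]
    refine ⟨hqF, (hu hqN.2.1).resolve_left fun hqe => ?_⟩
    exact Set.disjoint_left.1 (disjoint_face_skeleton hF) hqF
      (arc_diff_subset_skeleton j k ⟨hqe, hqN.2.2⟩)
  rw [closure_union] at hcl
  rcases hcl with hcl | hcl
  · exact ⟨j, k, true, p, hp', hcl⟩
  · exact ⟨j, k, false, p, hp', hcl⟩

/-- Visible parts of different objects are disjoint, so a vertex is counted for one object only, and
there for at most `c` arcs. -/
lemma sum_encard_vertices_inter_le :
    ∑ j, ∑ k, (stackingVertices D ∩ (((D j).arc k).carrier \ unionAbove D j)).encard ≤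
      c * (stackingVertices D).encard := by
  calc ∑ j, ∑ k, (stackingVertices D ∩ (((D j).arc k).carrier \ unionAbove D j)).encard
      ≤ ∑ j, c * (stackingVertices D ∩ ((D j).carrier \ unionAbove D j)).encard := by
        refine Finset.sum_le_sum fun j _ => ?_
        calc _ ≤ ∑ _k : Fin (D j).numArcs,
              (stackingVertices D ∩ ((D j).carrier \ unionAbove D j)).encard :=
            Finset.sum_le_sum fun k _ => encard_le_encard (inter_subset_inter_right _
              (sdiff_subset_sdiff_left (((D j).arc_subset_frontier k).trans
                (D j).frontier_subset)))
          _ ≤ _ := by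
            simp only [Finset.sum_const, Finset.card_univ, Fintype.card_fin, nsmul_eq_mul]
            gcongr
            exact_mod_cast (D j).numArcs_le
    _ ≤ c * (stackingVertices D).encard := by
        rw [← Finset.mul_sum]
        gcongr
        refine (sum_encard_le_mul_encard one_ne_zero (fun i _ => inter_subset_left) ?_).trans_eq
          (by simp)
        intro p _ T' _ hT'
        refine Finset.card_le_one.2 fun i hi j hj => ?_
        by_contra hij
        exact Set.disjoint_left.1 (disjoint_diff_unionAbove D hij) (hT' i hi).2 (hT' j hj).2

/-- The number of faces is bounded linearly in the number of edges and vertices. -/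
lemma numStackingFaces_le (h : GeneralPosition D) :
    numStackingFaces D ≤ 2 * (numStackingEdges D + c * (stackingVertices D).encard) := by
  choose a b γ τ S _ hγ hτ hτγ he hS using fun j k => ((D j).arc k).exists_param
  rw [numStackingFaces_eq]
  let 𝓕 (j : Fin n) (k : Fin (D j).numArcs) (s : Bool) : Set (Set (ℝ × ℝ)) :=
    {F ∈ faces D | ∃ p ∈ (((D j).arc k).carrier \ unionAbove D j) \ stackingVertices D,
      p ∈ closure (F ∩ S j k s)}
  have hcover : faces D ⊆ ⋃ j, ⋃ k, ⋃ s, 𝓕 j k s := by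
    intro F hF
    obtain ⟨j, k, s, hp⟩ := exists_side_of_face h hF S hS
    simp only [mem_iUnion]
    exact ⟨j, k, s, hF, hp⟩
  calc (faces D).encard ≤ (⋃ j, ⋃ k, ⋃ s, 𝓕 j k s).encard := encard_le_encard hcover
    _ ≤ ∑ j, ∑ k, ∑ s, (𝓕 j k s).encard := by
        refine (encard_iUnion_le_of_fintype _).trans (Finset.sum_le_sum fun j _ => ?_)
        refine (encard_iUnion_le_of_fintype _).trans (Finset.sum_le_sum fun k _ => ?_)
        exact encard_iUnion_le_of_fintype _
    _ ≤ ∑ j, ∑ k, 2 * ((components (((D j).arc k).carrier \ unionAbove D j)).encard +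
        (stackingVertices D ∩ (((D j).arc k).carrier \ unionAbove D j)).encard) := by
        refine Finset.sum_le_sum fun j _ => Finset.sum_le_sum fun k _ => ?_
        refine (Finset.sum_le_sum fun s _ => encard_faces_on_side_le h (hγ j k) (hτ j k) (hτγ j k)
          (he j k) (hS j k) s).trans_eq ?_
        simp [mul_add]
    _ = 2 * (numStackingEdges D + ∑ j, ∑ k,
        (stackingVertices D ∩ (((D j).arc k).carrier \ unionAbove D j)).encard) := by
        simp only [← Finset.mul_sum, Finset.sum_add_distrib, numStackingEdges]
    _ ≤ _ := by
        gcongr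
        exact sum_encard_vertices_inter_le

end Stack

/-! ### The cost of one layer, compared with the complexity of a union. -/

section Layers

variable (D : Fin n → PlanarObject c d)

/-- A bound for the contribution of `D i` to the complexity of a stacking, when `D i` is the lowest
of the objects in `T`, and the other objects in `T` are those above it. -/
noncomputable def layerCost (i : Fin n) (T : Finset (Fin n)) : ℕ∞ :=
  (2 * c + 1) * ((unionVertices D T ∩ frontier (D i).carrier).encard + 2 * c) +
    3 * ∑ k, (components (((D i).arc k).carrier \ unionOf D (T.erase i))).encard

variable {D}

/-- The factor 2 is the absence of triple boundary points. -/
lemma sum_encard_unionVertices_inter_le (h : GeneralPosition D) (T : Finset (Fin n)) :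
    ∑ i ∈ T, (unionVertices D T ∩ frontier (D i).carrier).encard ≤
      2 * (unionVertices D T).encard := by
  refine sum_encard_le_mul_encard two_ne_zero (fun _ _ => inter_subset_left) ?_
  intro p _ T' _ hT'
  by_contra! hlt
  obtain ⟨i, j, k, hi, hj, hk, hij, hik, hjk⟩ := Finset.two_lt_card_iff.1 hlt
  have := h.no_three i j k hij hik hjk
  exact (this ▸ ⟨⟨(hT' i hi).2, (hT' j hj).2⟩, (hT' k hk).2⟩ : p ∈ (∅ : Set (ℝ × ℝ)))

lemma sum_layerCost_le (h : GeneralPosition D) (T : Finset (Fin n)) :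
    ∑ i ∈ T, layerCost D i T ≤
      ((2 * c + 1) * (2 + 2 * c) + 3) * (unionComplexity D T + T.card) := by
  have h₁ : ∑ i ∈ T, layerCost D i T =
      (2 * c + 1) * ((∑ i ∈ T, (unionVertices D T ∩ frontier (D i).carrier).encard) +
        T.card * (2 * c)) + 3 * numUnionEdges D T := by
    simp only [layerCost, numUnionEdges, Finset.sum_add_distrib, ← Finset.mul_sum,
      Finset.sum_const, nsmul_eq_mul]
    ring
  rw [h₁]
  set V := (unionVertices D T).encard
  set E := numUnionEdges D T
  have hV : V ≤ unionComplexity D T + T.card := le_self_add.trans le_self_add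
  have hE : E ≤ unionComplexity D T + T.card := le_add_self.trans le_self_add
  have hT : (T.card : ℕ∞) ≤ unionComplexity D T + T.card := le_add_self
  calc _ ≤ (2 * c + 1) * (2 * V + T.card * (2 * c)) + 3 * E := by
        gcongr
        exact sum_encard_unionVertices_inter_le h T
    _ ≤ (2 * c + 1) * (2 * (unionComplexity D T + T.card) +
          (unionComplexity D T + T.card) * (2 * c)) + 3 * (unionComplexity D T + T.card) := by
        gcongr
    _ = _ := by ring

/-- The objects drawn at position `i` or later in the order `π`. -/
def upperSet (π : Equiv.Perm (Fin n)) (i : Fin n) : Finset (Fin n) :=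
  (Finset.Ici i).map π.toEmbedding

lemma unionAbove_comp (π : Equiv.Perm (Fin n)) (i : Fin n) :
    unionAbove (fun i => D (π i)) i = unionOf D ((upperSet π i).erase (π i)) := by
  ext p
  simp only [mem_unionAbove, unionOf, upperSet, mem_iUnion, Finset.mem_erase, Finset.mem_map,
    Finset.mem_Ici, Equiv.coe_toEmbedding, exists_prop]
  constructor
  · rintro ⟨j, hij, hj⟩
    exact ⟨π j, ⟨fun h => hij.ne' (π.injective h), j, hij.le, rfl⟩, hj⟩
  · rintro ⟨_, ⟨hne, j, hij, rfl⟩, hj⟩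
    exact ⟨j, lt_of_le_of_ne hij fun h => hne (h ▸ rfl), hj⟩

lemma GeneralPosition.comp (h : GeneralPosition D) (π : Equiv.Perm (Fin n)) :
    GeneralPosition fun i => D (π i) where
  finite_inter _ _ hij := h.finite_inter _ _ (π.injective.ne hij)
  crosses _ _ hij := h.crosses _ _ (π.injective.ne hij)
  no_three _ _ _ hij hik hjk :=
    h.no_three _ _ _ (π.injective.ne hij) (π.injective.ne hik) (π.injective.ne hjk)

/-- The intersections of the boundary of `D i` with that of the union of the objects above it are
vertices of the union of all these objects. -/
lemma frontier_inter_subset_unionVertices (h : GeneralPosition D) {i : Fin n}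
    {T : Finset (Fin n)} (hi : i ∈ T) :
    frontier (D i).carrier ∩ frontier (unionOf D (T.erase i)) ⊆ unionVertices D T := by
  rintro p ⟨hpi, hp⟩
  have hcl : ∀ T' : Finset (Fin n), IsClosed (unionOf D T') := fun T' =>
    isClosed_iUnion_of_finite fun j => isClosed_iUnion_of_finite fun _ => (D j).isClosed
  have hsub : ∀ j ∈ T.erase i, (D j).carrier ⊆ unionOf D (T.erase i) := fun j hj =>
    subset_biUnion_of_mem (u := fun j => (D j).carrier) (Finset.mem_coe.2 hj)
  have hfr : ∀ j ∈ T.erase i, p ∈ (D j).carrier → p ∈ frontier (D j).carrier := fun j hj hpj =>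
    ⟨subset_closure hpj, fun hint => hp.2 (interior_mono (hsub j hj) hint)⟩
  obtain ⟨j, hj, hpj⟩ : ∃ j ∈ T.erase i, p ∈ (D j).carrier := by
    simpa [unionOf] using (hcl _).frontier_subset hp
  have hpj' := hfr j hj hpj
  obtain ⟨hji, hjT⟩ := Finset.mem_erase.1 hj
  refine ⟨⟨subset_closure ?_, fun hint => ?_⟩, Or.inr ⟨i, hi, j, hjT, hji.symm, hpi, hpj'⟩⟩
  · exact mem_biUnion (Finset.mem_coe.2 hi) ((D i).frontier_subset hpi)
  · have hother : p ∉ unionOf D ((T.erase i).erase j) := by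
      intro hmem
      obtain ⟨k, hk, hpk⟩ : ∃ k ∈ (T.erase i).erase j, p ∈ (D k).carrier := by
        simpa [unionOf] using hmem
      obtain ⟨hkj, hk⟩ := Finset.mem_erase.1 hk
      have := h.no_three i j k hji.symm (Finset.ne_of_mem_erase hk).symm hkj.symm
      exact (this ▸ ⟨⟨hpi, hpj'⟩, hfr k hk hpk⟩ : p ∈ (∅ : Set (ℝ × ℝ)))
    -- If `p` were interior to the union, the proper crossing would give a point `q` near `p` on the
    -- boundary of `D j` and outside `D i`. Only `D j` can cover points near `q`, so `q` would be
    -- interior to `D j`.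
    have hN : interior (unionOf D T) ∩ (unionOf D ((T.erase i).erase j))ᶜ ∈ 𝓝 p :=
      Filter.inter_mem (isOpen_interior.mem_nhds hint) ((hcl _).isOpen_compl.mem_nhds hother)
    obtain ⟨q, hqN, hqj, hqi⟩ :=
      mem_closure_iff_nhds.1 (h.crosses i j hji.symm p ⟨hpi, hpj'⟩).2 _ hN
    refine hqj.2 (mem_interior_iff_mem_nhds.2 ?_)
    filter_upwards [isOpen_interior.mem_nhds hqN.1, (hcl _).isOpen_compl.mem_nhds hqN.2,
      (D i).isClosed.isOpen_compl.mem_nhds hqi] with x hx hx' hxi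
    obtain ⟨k, hk, hxk⟩ : ∃ k ∈ T, x ∈ (D k).carrier := by
      simpa [unionOf] using interior_subset hx
    have hki : k ≠ i := by rintro rfl; exact hxi hxk
    by_cases hkj : k = j
    · exact hkj ▸ hxk
    · exact absurd (mem_biUnion (Finset.mem_coe.2 (Finset.mem_erase.2
        ⟨hkj, Finset.mem_erase.2 ⟨hki, hk⟩⟩)) hxk) hx'

lemma stackingComplexity_comp_le (h : GeneralPosition D) (π : Equiv.Perm (Fin n)) :
    stackingComplexity (fun i => D (π i)) ≤ ∑ i, layerCost D (π i) (upperSet π i) := by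
  set V := (stackingVertices fun i => D (π i)).encard with hV
  set E := numStackingEdges fun i => D (π i) with hE
  have hVle : V ≤ ∑ i, ((unionVertices D (upperSet π i) ∩ frontier (D (π i)).carrier).encard +
      2 * c) := by
    rw [hV, stackingVertices]
    refine (encard_iUnion_le_of_fintype _).trans (Finset.sum_le_sum fun i _ => ?_)
    refine (encard_union_le _ _).trans (add_le_add (encard_le_encard ?_)
      ((encard_le_encard sdiff_subset).trans (D (π i)).encard_vertices_le))
    refine subset_inter ?_ inter_subset_left
    rw [unionAbove_comp]
    exact frontier_inter_subset_unionVertices h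
      (Finset.mem_map_of_mem _ (Finset.mem_Ici.2 le_rfl))
  have hEeq : E = ∑ i, ∑ k, (components (((D (π i)).arc k).carrier \
      unionOf D ((upperSet π i).erase (π i)))).encard := by
    simp only [hE, numStackingEdges, unionAbove_comp]
  -- Faces cost at most `2 * (E + c * V)`; hence the weights `2 * c + 1` and `3` in `layerCost`.
  calc stackingComplexity (fun i => D (π i)) ≤ V + E + 2 * (E + c * V) := by
        unfold stackingComplexity
        gcongr
        exact numStackingFaces_le (h.comp π)
    _ = (2 * c + 1) * V + 3 * E := by ring
    _ ≤ (2 * c + 1) * (∑ i, ((unionVertices D (upperSet π i) ∩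
          frontier (D (π i)).carrier).encard + 2 * c)) + 3 * E := by gcongr
    _ = _ := by
        rw [hEeq]
        simp only [layerCost, ← Finset.mul_sum, Finset.sum_add_distrib]

end Layers

/-! ### Averaging over permutations. -/

/-- Backwards analysis: given the set of the objects at position `i` or later, each of them is
equally likely to be the one at position `i`. -/
lemma card_mul_sum_perm_le (f : Fin n → Finset (Fin n) → ℝ≥0∞) (i : Fin n) (b : ℝ≥0∞)
    (hf : ∀ T : Finset (Fin n), T.card = n - i → ∑ x ∈ T, f x T ≤ b) :
    ((n - i : ℕ) : ℝ≥0∞) * ∑ π : Equiv.Perm (Fin n), f (π i) (upperSet π i) ≤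
      Fintype.card (Equiv.Perm (Fin n)) * b := by
  have hsymm : ∀ l ∈ Finset.Ici i, ∑ π : Equiv.Perm (Fin n), f (π l) (upperSet π i) =
      ∑ π : Equiv.Perm (Fin n), f (π i) (upperSet π i) := by
    intro l hl
    -- Swapping positions `i` and `l ≥ i` preserves the set of objects at position `i` or later.
    refine Fintype.sum_equiv (Equiv.mulRight (Equiv.swap i l)) _ _ fun π => ?_
    have hset : upperSet (π * Equiv.swap i l) i = upperSet π i := by
      ext x
      simp only [upperSet, Finset.mem_map, Finset.mem_Ici, Equiv.coe_toEmbedding,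
        Equiv.Perm.mul_apply]
      rw [Finset.mem_Ici] at hl
      have hswap : ∀ y, i ≤ y → i ≤ Equiv.swap i l y := by
        intro y hy
        rw [Equiv.swap_apply_def]
        split_ifs <;> first | exact hl | exact le_rfl | exact hy
      constructor
      · rintro ⟨y, hy, rfl⟩
        exact ⟨_, hswap y hy, rfl⟩
      · rintro ⟨y, hy, rfl⟩
        exact ⟨_, hswap y hy, by simp⟩
    simp [hset]
  have hcard : ∀ π : Equiv.Perm (Fin n), (upperSet π i).card = n - i := by
    intro π
    simp [upperSet]
  calc ((n - i : ℕ) : ℝ≥0∞) * ∑ π : Equiv.Perm (Fin n), f (π i) (upperSet π i)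
      = ∑ l ∈ Finset.Ici i, ∑ π : Equiv.Perm (Fin n), f (π l) (upperSet π i) := by
        rw [Finset.sum_congr rfl hsymm, Finset.sum_const, nsmul_eq_mul, Fin.card_Ici]
    _ = ∑ π : Equiv.Perm (Fin n), ∑ x ∈ upperSet π i, f x (upperSet π i) := by
        rw [Finset.sum_comm]
        refine Finset.sum_congr rfl fun π _ => ?_
        conv_rhs => rw [upperSet, Finset.sum_map]
        rfl
    _ ≤ ∑ _π : Equiv.Perm (Fin n), b := Finset.sum_le_sum fun π _ => hf _ (hcard π)
    _ = _ := by rw [Finset.sum_const, nsmul_eq_mul, Finset.card_univ]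

/-- This forces `U 1 ≥ 1`, so that the additive term `T.card` in `sum_layerCost_le` can be absorbed
into `U`. -/
lemma one_le_unionComplexity_singleton (D : Fin n → PlanarObject c d) (i : Fin n) :
    1 ≤ unionComplexity D {i} := by
  refine le_trans ?_ (le_add_self (a := numUnionEdges D {i}))
  rw [numUnionEdges, Finset.sum_singleton]
  refine le_trans ?_ (Finset.single_le_sum (fun _ _ => zero_le)
    (Finset.mem_univ ⟨0, (D i).numArcs_pos⟩))
  rw [one_le_encard_iff_nonempty]
  obtain ⟨x, hx⟩ := ((D i).arc ⟨0, (D i).numArcs_pos⟩).nonempty_carrier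
  exact ⟨_, x, ⟨hx, by simp [unionOf]⟩, rfl⟩

end Stacking

theorem mainTheorem7 (c d : ℕ) (κ : ℝ≥0) :
    ∃ C : ℝ≥0, ∀ (U : ℕ → ℝ≥0),
      (∀ m n : ℕ, 1 ≤ m → m ≤ n → U m / m ≤ κ * (U n / n)) →
      ∀ (n : ℕ) (D : Fin n → Stacking.PlanarObject c d), Stacking.GeneralPosition D →
        (∀ T : Finset (Fin n), (Stacking.unionComplexity D T : ℝ≥0∞) ≤ (U T.card : ℝ≥0∞)) →
        Stacking.expectedStackingComplexity D ≤ (C : ℝ≥0∞) * (U n : ℝ≥0∞) := by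
  open Stacking in
  set M : ℕ := (2 * c + 1) * (2 + 2 * c) + 3 with hM
  -- `M` is the factor in `sum_layerCost_le`, `2` comes from `U m + m ≤ 2 * L * m`, and `κ` from the
  -- growth condition.
  refine ⟨2 * M * κ, fun U hU n D hD hT => ?_⟩
  set L : ℝ≥0 := κ * (U n / n) with hL
  have hnL : (n : ℝ≥0∞) * (2 * M * L : ℝ≥0) ≤ ((2 * M * κ : ℝ≥0) : ℝ≥0∞) * U n := by
    rcases Nat.eq_zero_or_pos n with rfl | hn
    · simp
    · have hn' : (n : ℝ≥0) ≠ 0 := by exact_mod_cast hn.ne'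
      have : (n : ℝ≥0) * (2 * M * L) = 2 * M * κ * U n := by
        rw [hL]; field_simp
      exact_mod_cast this.le
  have hUm : ∀ m : ℕ, 1 ≤ m → m ≤ n → U m + m ≤ m * (2 * L) := by
    intro m hm hmn
    -- The growth condition from `1` to `n` gives `1 ≤ U 1 ≤ L`.
    have h1 : (1 : ℝ≥0) ≤ L := by
      have hi := hT {⟨0, by omega⟩}
      have h1U : (1 : ℝ≥0∞) ≤ U 1 := by
        refine le_trans ?_ (by simpa using hi)
        exact_mod_cast one_le_unionComplexity_singleton D ⟨0, by omega⟩
      have := hU 1 n le_rfl (hm.trans hmn)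
      rw [Nat.cast_one, div_one] at this
      exact (by exact_mod_cast h1U : (1 : ℝ≥0) ≤ U 1).trans this
    have hm' : (0 : ℝ≥0) < m := by exact_mod_cast hm
    have h2 : U m ≤ L * m := (div_le_iff₀ hm').1 (hU m n hm hmn)
    calc U m + m ≤ L * m + L * m := add_le_add h2 (le_mul_of_one_le_left hm'.le h1)
      _ = m * (2 * L) := by ring
  have hlayer : ∀ i : Fin n, ∑ π : Equiv.Perm (Fin n),
      (layerCost D (π i) (upperSet π i) : ℝ≥0∞) ≤
        Fintype.card (Equiv.Perm (Fin n)) * (2 * M * L : ℝ≥0) := by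
    intro i
    have hpos : 1 ≤ n - i := by omega
    have hb := card_mul_sum_perm_le (fun x T => (layerCost D x T : ℝ≥0∞)) i
      ((n - i : ℕ) * (2 * M * L : ℝ≥0)) ?_
    -- The number `n - i` of candidates for the lowest object cancels, leaving a bound independent
    -- of `i`.
    · rw [mul_left_comm] at hb
      exact (ENNReal.mul_le_mul_iff_right (by exact_mod_cast Nat.one_le_iff_ne_zero.1 hpos)
        (ENNReal.natCast_ne_top _)).1 hb
    · intro T hTc
      calc ∑ x ∈ T, (layerCost D x T : ℝ≥0∞) = ((∑ x ∈ T, layerCost D x T : ℕ∞) : ℝ≥0∞) :=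
            (map_sum ENat.toENNRealRingHom _ _).symm
        _ ≤ (((M : ℕ∞) * (unionComplexity D T + T.card) : ℕ∞) : ℝ≥0∞) := by
            refine ENat.toENNReal_mono ?_
            rw [hM]
            exact_mod_cast sum_layerCost_le hD T
        _ = M * ((unionComplexity D T : ℝ≥0∞) + T.card) := by
            push_cast
            rfl
        _ ≤ M * ((U T.card : ℝ≥0∞) + T.card) := by
            gcongr
            exact hT T
        _ ≤ _ := by
            rw [hTc]
            have := mul_le_mul_right (hUm (n - i) hpos (Nat.sub_le _ _)) (M : ℝ≥0)
            calc _ = ((M * (U (n - i) + (n - i : ℕ)) : ℝ≥0) : ℝ≥0∞) := by push_cast; rfl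
              _ ≤ ((M * ((n - i : ℕ) * (2 * L)) : ℝ≥0) : ℝ≥0∞) := by exact_mod_cast this
              _ = _ := by push_cast; ring
  unfold expectedStackingComplexity
  refine ENNReal.div_le_of_le_mul ?_
  calc ∑ π : Equiv.Perm (Fin n), (stackingComplexity (fun i => D (π i)) : ℝ≥0∞)
      ≤ ∑ π : Equiv.Perm (Fin n), ∑ i, (layerCost D (π i) (upperSet π i) : ℝ≥0∞) := by
        refine Finset.sum_le_sum fun π _ => ?_
        refine (ENat.toENNReal_mono (stackingComplexity_comp_le hD π)).trans_eq ?_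
        exact map_sum ENat.toENNRealRingHom _ _
    _ = ∑ i, ∑ π : Equiv.Perm (Fin n), (layerCost D (π i) (upperSet π i) : ℝ≥0∞) :=
        Finset.sum_comm
    _ ≤ ∑ _i : Fin n, Fintype.card (Equiv.Perm (Fin n)) * ((2 * M * L : ℝ≥0) : ℝ≥0∞) :=
        Finset.sum_le_sum fun i _ => hlayer i
    _ = Fintype.card (Equiv.Perm (Fin n)) * (n * ((2 * M * L : ℝ≥0) : ℝ≥0∞)) := by
        rw [Finset.sum_const, Finset.card_univ, Fintype.card_fin, nsmul_eq_mul]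
        ring
    _ ≤ Fintype.card (Equiv.Perm (Fin n)) * (((2 * M * κ : ℝ≥0) : ℝ≥0∞) * U n) := by
        gcongr
    _ = _ := mul_comm _ _
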